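/- **Setting.** There are $n\ge 2$ forecasters and $m\ge 1$ independent binary events. Event $t$ occurs (that is, $y_t=1$) with an unknown probability $\theta_t\in[0,1]$, and forecaster $i$ has belief $p_{it}\in[0,1]$ about it; write $P=(p_{it})\in[0,1]^{n\times m}$ and $\vec\theta=(\theta_1,\dots,\theta_m)$. The accuracy of forecaster $i$ is $a_i = 1-\frac1m\sum_{t=1}^m (p_{it}-\theta_t)^2$, and $i$ is $\epsilon$-optimal if $a_i\ge \max_j a_j-\epsilon$. A forecasting competition on $n$ forecasters and $m$ events is a function $M_{n,m}:[0,1]^{n\times m}\times\{0,1\}^m\to\Delta_n$, where $\Delta_n$ is the probability simplex over $\{1,\dots,n\}$ and $M_{n,m}(R,\vec y)_i$ is the probability that $i$ wins on reports $R$ and outcomes $\vec y$; a mechanism $M$ is a family $(M_{n,m})$ of such functions. In the nonstrategic setting the competition is run on the true beliefs, $R=P$. There, it is called $(\epsilon,\delta)$-accurate if for all $P$ and all $\vec\theta$, with probability at least $1-\delta$ over independent outcomes $y_t\sim\mathrm{Bernoulli}(\theta_t)$ and $i\sim M_{n,m}(P,\vec y)$, the winner $i$ is $\epsilon$-optimal.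 The nonstrategic event complexity $m^*(n,\epsilon,\delta)$ of a mechanism $M$ is the smallest $m\ge1$ for which $M_{n,m}$ is $(\epsilon,\delta)$-accurate in the nonstrategic setting ($\infty$ if there is none). **Theorem.** There exist constants $C>0$, $\delta_0\in(0,\tfrac18)$ and $\epsilon_0>0$ such that the following hold for all $0<\epsilon<\epsilon_0$ and all $n\ge 2$. 1. If a forecasting competition on $n$ forecasters and $m\ge1$ events is $(\epsilon,\delta_0)$-accurate in the nonstrategic setting, then $m\ge \dfrac{C\log n}{\epsilon^2}$. 2. The nonstrategic event complexity of every mechanism satisfies $m^*(n,\epsilon,\tfrac18)\ge \dfrac{C\log n}{\epsilon^2}$. -/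

import Mathlib

/-- The component `M_{n,m}` of a forecasting competition mechanism: from an `n × m` matrix of
reported probabilities and the `m` observed binary outcomes it produces a probability distribution
over the `n` forecasters, according to which the winner is drawn. -/
def Competition (n m : ℕ) : Type :=
  (Fin n → Fin m → unitInterval) → (Fin m → Bool) → stdSimplex ℝ (Fin n)

/-- A forecasting competition mechanism: a family of functions `M_{n,m}`, one for each number
`n ≥ 2` of forecasters and each number `m` of events. -/
def ForecastingMechanism : Type :=
  ∀ n m : ℕ, 2 ≤ n → Competition n m

/-- The probability of the outcome vector `y` when the events are independent and event `t` occurs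
with probability `θ t`. -/
noncomputable def outcomeProb {m : ℕ} (θ : Fin m → unitInterval) (y : Fin m → Bool) : ℝ :=
  ∏ t, if y t = true then (θ t : ℝ) else 1 - (θ t : ℝ)

/-- The accuracy `1 - (1/m) ∑ₜ (pₜ - θₜ)²` of a forecaster with beliefs `p`. -/
noncomputable def accuracy {m : ℕ} (p θ : Fin m → unitInterval) : ℝ :=
  1 - (1 / (m : ℝ)) * ∑ t, ((p t : ℝ) - (θ t : ℝ)) ^ 2

/-- Forecaster `i` is `ε`-optimal: the accuracy of `i` is at least the maximal accuracy of a
forecaster minus `ε`. -/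
def IsEpsOptimal {n m : ℕ} (P : Fin n → Fin m → unitInterval) (θ : Fin m → unitInterval)
    (ε : ℝ) (i : Fin n) : Prop :=
  ∀ j, accuracy (P j) θ - ε ≤ accuracy (P i) θ

open Classical in
/-- The probability, over independent outcomes `y ∼ θ` and the winner `i ∼ M(P, y)`, that the
winner is `ε`-optimal, when the mechanism is run on the true beliefs `P`. -/
noncomputable def probSelectsEpsOptimal {n m : ℕ} (M : Competition n m)
    (P : Fin n → Fin m → unitInterval) (θ : Fin m → unitInterval) (ε : ℝ) : ℝ :=
  ∑ y : Fin m → Bool, outcomeProb θ y *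
    ∑ i : Fin n, if IsEpsOptimal P θ ε i then (M P y).1 i else 0

/-- With access to the true beliefs, the competition selects an `ε`-optimal forecaster with
probability at least `1 - δ`, for all beliefs `P` and all ground truths `θ`. -/
def IsNonstrategicallyAccurate {n m : ℕ} (M : Competition n m) (ε δ : ℝ) : Prop :=
  ∀ (P : Fin n → Fin m → unitInterval) (θ : Fin m → unitInterval),
    1 - δ ≤ probSelectsEpsOptimal M P θ ε

/-- The nonstrategic event complexity `m*(n, ε, δ)` of a mechanism: the smallest number `m ≥ 1` of
events for which it is accurate given the true beliefs (`⊤` if there is none). -/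
noncomputable def nonstrategicEventComplexity (M : ForecastingMechanism) (n : ℕ) (hn : 2 ≤ n)
    (ε δ : ℝ) : ℕ∞ :=
  ⨅ (m : ℕ) (_ : 1 ≤ m ∧ IsNonstrategicallyAccurate (M n m hn) ε δ), (m : ℕ∞)

/-! Selecting an `ε`-optimal forecaster is made as hard as decoding. Forecasters predict words of a
code of relative distance above 1/4 (`exists_code`), and the truth is 1/2 shifted by `2ε` towards
one word `x`. Only forecasters following `x` are then `ε`-optimal
(`eq_of_isEpsOptimal_bitForecast`), so an accurate competition decodes `x` from the outcomes. These
outcome laws are nearly uniform: a second-moment bound allows only `exp (16 ε² m)` words up to a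
constant (`card_code_le_of_accurate`). With `n` words this gives the theorem; a code with fewer
words is still exponential in `m`, which is impossible for small `ε`. -/

/-- Sum over all bit strings of a product of weights, one weight for agreement with a fixed string
and another for disagreement. -/
theorem sum_prod_agreement_weights {m : ℕ} (x : Fin m → Bool) (a b : ℝ) :
    ∑ y : Fin m → Bool, ∏ t, (if x t = y t then a else b) = (a + b) ^ m := by
  have h := (Fintype.prod_sum (fun (t : Fin m) (c : Bool) => if x t = c then a else b)).symm
  rw [h]
  have h2 : ∀ t : Fin m, ∑ c : Bool, (if x t = c then a else b) = a + b := by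
    intro t
    cases x t <;> simp [add_comm]
  rw [Finset.prod_congr rfl fun t _ => h2 t, Finset.prod_const, Finset.card_univ,
    Fintype.card_fin]

theorem prod_agreement_weights_eq_pow_hammingDist {m : ℕ} (x y : Fin m → Bool) (b : ℝ) :
    ∏ t, (if x t = y t then 1 else b) = b ^ hammingDist x y := by
  rw [hammingDist, Finset.prod_ite]
  simp

/-- A Hamming ball of radius `m / 4` in `{0,1}^m` has at most `(√2 · 5/4)^m` points. -/
theorem card_hammingBall_le {m : ℕ} (x : Fin m → Bool) :
    (({y : Fin m → Bool | 4 * hammingDist x y ≤ m} : Finset _).card : ℝ)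
      ≤ (√2 * (5 / 4)) ^ m := by
  -- Chernoff-style count: each point of the ball has weight at least `4 ^ (-m/4) = √2 ^ (-m)` in
  -- this sum.
  have hsum : ∑ y : Fin m → Bool, (1 / 4 : ℝ) ^ hammingDist x y = (5 / 4) ^ m := by
    simp_rw [← prod_agreement_weights_eq_pow_hammingDist]
    rw [sum_prod_agreement_weights]
    norm_num
  have h1 : (1 : ℝ) ≤ √2 := Real.one_le_sqrt.2 (by norm_num)
  have h4 : √2 ^ 4 = 4 := by
    have := Real.sq_sqrt (show (0 : ℝ) ≤ 2 by norm_num)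
    calc √2 ^ 4 = (√2 ^ 2) ^ 2 := by ring
      _ = 4 := by rw [this]; norm_num
  rw [mul_pow, ← hsum, Finset.mul_sum, Finset.card_eq_sum_ones, Nat.cast_sum, Finset.sum_filter]
  refine Finset.sum_le_sum fun y _ => ?_
  split_ifs with h
  · have hp : (4 : ℝ) ^ hammingDist x y ≤ √2 ^ m := by
      rw [← h4, ← pow_mul]
      exact pow_le_pow_right₀ h1 h
    rw [one_div, inv_pow, ← div_eq_mul_inv, le_div_iff₀ (by positivity)]
    simpa using hp
  · positivity

/-- Gilbert–Varshamov: there is a code in `{0,1}^m` of relative distance more than `1/4` which has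
at least two words and exponentially many words. -/
theorem exists_code {m : ℕ} (hm : 1 ≤ m) :
    ∃ S : Finset (Fin m → Bool), 2 ≤ S.card ∧ (2 : ℝ) ^ m ≤ S.card * (√2 * (5 / 4)) ^ m ∧
      ∀ x ∈ S, ∀ y ∈ S, x ≠ y → m < 4 * hammingDist x y := by
  classical
  let 𝒞 : Finset (Finset (Fin m → Bool)) :=
    {S | ∀ x ∈ S, ∀ y ∈ S, x ≠ y → m < 4 * hammingDist x y}
  have hpair : ({fun _ => false, fun _ => true} : Finset (Fin m → Bool)) ∈ 𝒞 := by
    have h1 : hammingDist (fun _ : Fin m => false) (fun _ => true) = m := by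
      simp [hammingDist]
    have h2 : hammingDist (fun _ : Fin m => true) (fun _ => false) = m := by
      simp [hammingDist]
    simp only [𝒞, Finset.mem_filter, Finset.mem_univ, true_and, Finset.mem_insert,
      Finset.mem_singleton]
    rintro x (rfl | rfl) y (rfl | rfl) hxy
    · exact absurd rfl hxy
    · omega
    · omega
    · exact absurd rfl hxy
  -- Maximality gives both size bounds: `S` is at least as large as the pair, and balls around its
  -- words cover the cube, since an uncovered point could be added.
  obtain ⟨S, hS, hmax⟩ := Finset.exists_max_image 𝒞 Finset.card ⟨_, hpair⟩
  have hcode : ∀ x ∈ S, ∀ y ∈ S, x ≠ y → m < 4 * hammingDist x y := by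
    simpa [𝒞] using hS
  refine ⟨S, ?_, ?_, hcode⟩
  · have h := hmax _ hpair
    rwa [Finset.card_pair] at h
    intro h
    exact absurd (congrFun h ⟨0, hm⟩) (by simp)
  · have hcover : (Finset.univ : Finset (Fin m → Bool)) ⊆
        S.biUnion fun x => {y | 4 * hammingDist x y ≤ m} := by
      intro y _
      by_contra hy
      simp only [Finset.mem_biUnion, Finset.mem_filter, Finset.mem_univ, true_and, not_exists,
        not_and, not_le] at hy
      have hyS : y ∉ S := fun h => by simpa using hy y h
      have hins : insert y S ∈ 𝒞 := by
        simp only [𝒞, Finset.mem_filter, Finset.mem_univ, true_and, Finset.mem_insert]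
        rintro a (rfl | ha) b (rfl | hb) hab
        · exact absurd rfl hab
        · rw [hammingDist_comm]; exact hy b hb
        · exact hy a ha
        · exact hcode a ha b hb hab
      have := hmax _ hins
      rw [Finset.card_insert_of_notMem hyS] at this
      omega
    have hcard := (Finset.card_le_card hcover).trans Finset.card_biUnion_le
    have hcard' : ((2 : ℝ) ^ m) ≤
        ∑ x ∈ S, (({y | 4 * hammingDist x y ≤ m} : Finset (Fin m → Bool)).card : ℝ) := by
      have h : (2 ^ m : ℕ) ≤
          ∑ x ∈ S, ({y | 4 * hammingDist x y ≤ m} : Finset (Fin m → Bool)).card := by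
        simpa using hcard
      exact_mod_cast h
    calc (2 : ℝ) ^ m ≤ _ := hcard'
      _ ≤ ∑ _x ∈ S, (√2 * (5 / 4)) ^ m := Finset.sum_le_sum fun x _ => card_hammingBall_le x
      _ = _ := by simp

/-- The deterministic forecast predicting the bit string `x`. -/
def bitForecast {m : ℕ} (x : Fin m → Bool) : Fin m → unitInterval :=
  fun t => if x t then 1 else 0

/-- The ground truth whose coordinates deviate from `1/2` by `η` in the direction of `x`. -/
noncomputable def biasedTruth {m : ℕ} (η : ℝ) (h0 : 0 ≤ η) (h1 : η ≤ 1 / 2) (x : Fin m → Bool) :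
    Fin m → unitInterval :=
  fun t => if x t then ⟨1 / 2 + η, by constructor <;> linarith⟩
    else ⟨1 / 2 - η, by constructor <;> linarith⟩

theorem outcomeProb_biasedTruth {m : ℕ} {η : ℝ} (h0 : 0 ≤ η) (h1 : η ≤ 1 / 2)
    (x y : Fin m → Bool) :
    outcomeProb (biasedTruth η h0 h1 x) y =
      ∏ t, if x t = y t then 1 / 2 + η else 1 / 2 - η := by
  refine Finset.prod_congr rfl fun t _ => ?_
  cases hx : x t <;> cases hy : y t <;> simp [biasedTruth, hx] <;> ring

theorem sum_outcomeProb_biasedTruth_sq {m : ℕ} {η : ℝ} (h0 : 0 ≤ η) (h1 : η ≤ 1 / 2)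
    (x : Fin m → Bool) :
    ∑ y, outcomeProb (biasedTruth η h0 h1 x) y ^ 2 = (1 / 2 + 2 * η ^ 2) ^ m := by
  simp_rw [outcomeProb_biasedTruth, ← Finset.prod_pow, ite_pow]
  rw [sum_prod_agreement_weights]
  ring

theorem accuracy_bitForecast_biasedTruth {m : ℕ} (hm : 1 ≤ m) {η : ℝ} (h0 : 0 ≤ η)
    (h1 : η ≤ 1 / 2) (x z : Fin m → Bool) :
    accuracy (bitForecast z) (biasedTruth η h0 h1 x) =
      1 - (1 / 2 - η) ^ 2 - 2 * η * hammingDist x z / m := by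
  have hsum : ∑ t, ((bitForecast z t : ℝ) - biasedTruth η h0 h1 x t) ^ 2 =
      m * (1 / 2 - η) ^ 2 + 2 * η * hammingDist x z := by
    have hterm : ∀ t, ((bitForecast z t : ℝ) - biasedTruth η h0 h1 x t) ^ 2 =
        (1 / 2 - η) ^ 2 + 2 * η * (if x t ≠ z t then 1 else 0) := by
      intro t
      cases hx : x t <;> cases hz : z t <;> simp [bitForecast, biasedTruth, hx, hz] <;> ring
    simp_rw [hterm]
    rw [Finset.sum_add_distrib, ← Finset.mul_sum, Finset.sum_boole]
    simp [hammingDist]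
  have hm' : (m : ℝ) ≠ 0 := by positivity
  rw [accuracy, hsum]
  field_simp
  ring

/-- With bias `2ε`, disagreeing on a fraction above 1/4 of the events costs more than `4ε · 1/4 = ε`
in accuracy. -/
theorem eq_of_isEpsOptimal_bitForecast {n m : ℕ} (hm : 1 ≤ m) {ε : ℝ} (hε : 0 < ε)
    (h0 : 0 ≤ 2 * ε) (h1 : 2 * ε ≤ 1 / 2) {g : Fin n → Fin m → Bool}
    (hg : ∀ i j, g i ≠ g j → m < 4 * hammingDist (g i) (g j)) {i j : Fin n}
    (h : IsEpsOptimal (fun k => bitForecast (g k)) (biasedTruth (2 * ε) h0 h1 (g j)) ε i) :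
    g i = g j := by
  by_contra hne
  have hd : (m : ℝ) < 4 * hammingDist (g j) (g i) := by exact_mod_cast hg j i (Ne.symm hne)
  have hj := h j
  rw [accuracy_bitForecast_biasedTruth hm, accuracy_bitForecast_biasedTruth hm,
    hammingDist_self] at hj
  have hm' : (0 : ℝ) < m := by exact_mod_cast hm
  have hgap : ε < 2 * (2 * ε) * hammingDist (g j) (g i) / m := by
    rw [lt_div_iff₀ hm']
    nlinarith
  simp only [Nat.cast_zero, mul_zero, zero_div] at hj
  linarith

theorem outcomeProb_nonneg {m : ℕ} (θ : Fin m → unitInterval) (y : Fin m → Bool) :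
    0 ≤ outcomeProb θ y := by
  refine Finset.prod_nonneg fun t _ => ?_
  split_ifs
  · exact (θ t).2.1
  · linarith [(θ t).2.2]

open Classical in
/-- A competition selecting, among `T.card` separated code words, the one followed by the truth
with probability at least `7/8`, forces `T.card` to be at most exponential in `ε² m`. -/
theorem card_code_le_of_accurate {n m : ℕ} (hm : 1 ≤ m) {ε : ℝ} (hε : 0 < ε) (hε' : ε ≤ 1 / 4)
    {M : Competition n m} (hM : IsNonstrategicallyAccurate M ε (1 / 8))
    {T : Finset (Fin m → Bool)} (hT : T.Nonempty) (hTn : T.card ≤ n)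
    (hcode : ∀ x ∈ T, ∀ y ∈ T, x ≠ y → m < 4 * hammingDist x y) :
    49 / 64 * (T.card : ℝ) ≤ Real.exp (16 * ε ^ 2 * m) := by
  have h0 : 0 ≤ 2 * ε := by linarith
  have h1 : 2 * ε ≤ 1 / 2 := by linarith
  have : Nonempty T := hT.to_subtype
  obtain ⟨e⟩ : Nonempty (T ↪ Fin n) := Function.Embedding.nonempty_of_card_le (by simpa using hTn)
  -- Several forecasters may share a word, which covers `T.card < n`.
  obtain ⟨g, hgsurj⟩ : ∃ g : Fin n → T, Function.Surjective g :=
    ⟨_, Function.invFun_surjective e.injective⟩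
  set P : Fin n → Fin m → unitInterval := fun k => bitForecast (g k).1 with hP
  -- `f x y` is the probability that the winner follows `x` on outcomes `y`: a randomized decoder.
  let f : (Fin m → Bool) → (Fin m → Bool) → ℝ :=
    fun x y => ∑ i, if (g i).1 = x then (M P y).1 i else 0
  have hMnn : ∀ y i, 0 ≤ (M P y).1 i := fun y => (M P y).2.1
  have hMsum : ∀ y, ∑ i, (M P y).1 i = 1 := fun y => (M P y).2.2
  have hfnn : ∀ x y, 0 ≤ f x y := fun x y =>
    Finset.sum_nonneg fun i _ => by split_ifs; exacts [hMnn y i, le_rfl]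
  have hfle : ∀ x y, f x y ≤ 1 := fun x y => by
    rw [← hMsum y]
    exact Finset.sum_le_sum fun i _ => by split_ifs; exacts [le_rfl, hMnn y i]
  have hfsum : ∀ y, ∑ x ∈ T, f x y = 1 := fun y => by
    rw [← hMsum y, Finset.sum_comm]
    refine Finset.sum_congr rfl fun i _ => ?_
    rw [Finset.sum_ite_eq, if_pos (g i).2]
  have hsel : ∀ x ∈ T, 49 / 64 ≤ (1 / 2 + 8 * ε ^ 2) ^ m * ∑ y, f x y := by
    intro x hx
    obtain ⟨j, hj⟩ := hgsurj ⟨x, hx⟩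
    have hjx : (g j).1 = x := by rw [hj]
    have hacc := hM P (biasedTruth (2 * ε) h0 h1 x)
    have hle : probSelectsEpsOptimal M P (biasedTruth (2 * ε) h0 h1 x) ε ≤
        ∑ y, outcomeProb (biasedTruth (2 * ε) h0 h1 x) y * f x y := by
      refine Finset.sum_le_sum fun y _ =>
        mul_le_mul_of_nonneg_left (Finset.sum_le_sum fun i _ => ?_) (outcomeProb_nonneg _ _)
      by_cases hopt : IsEpsOptimal P (biasedTruth (2 * ε) h0 h1 x) ε i
      · have : (g i).1 = (g j).1 := by
          rw [← hjx] at hopt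
          refine eq_of_isEpsOptimal_bitForecast (g := fun k => (g k).1) hm hε h0 h1 ?_ hopt
          exact fun a b hab => hcode _ (g a).2 _ (g b).2 hab
        rw [if_pos hopt, if_pos (this.trans hjx)]
      · rw [if_neg hopt]
        split_ifs
        exacts [hMnn y i, le_rfl]
    -- Cauchy–Schwarz separates the law of `y` from the decoder; `f² ≤ f` then leaves a quantity
    -- whose sum over `x ∈ T` is `2 ^ m`.
    have hcs := Finset.sum_mul_sq_le_sq_mul_sq Finset.univ
      (fun y => outcomeProb (biasedTruth (2 * ε) h0 h1 x) y) (f x)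
    rw [sum_outcomeProb_biasedTruth_sq] at hcs
    have hsq : ∑ y, f x y ^ 2 ≤ ∑ y, f x y :=
      Finset.sum_le_sum fun y _ => by nlinarith [hfnn x y, hfle x y]
    have h78 : (7 / 8 : ℝ) ≤ ∑ y, outcomeProb (biasedTruth (2 * ε) h0 h1 x) y * f x y := by
      linarith
    calc (49 / 64 : ℝ) = (7 / 8) ^ 2 := by norm_num
      _ ≤ _ := pow_le_pow_left₀ (by norm_num) h78 2
      _ ≤ _ := hcs
      _ ≤ (1 / 2 + 2 * (2 * ε) ^ 2) ^ m * ∑ y, f x y :=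
        mul_le_mul_of_nonneg_left hsq (by positivity)
      _ = _ := by ring
  calc 49 / 64 * (T.card : ℝ) = ∑ _x ∈ T, (49 / 64 : ℝ) := by simp [mul_comm]
    _ ≤ ∑ x ∈ T, (1 / 2 + 8 * ε ^ 2) ^ m * ∑ y, f x y := Finset.sum_le_sum hsel
    _ = (1 / 2 + 8 * ε ^ 2) ^ m * 2 ^ m := by
      rw [← Finset.mul_sum, Finset.sum_comm]
      simp [hfsum]
    _ = (16 * ε ^ 2 + 1) ^ m := by rw [← mul_pow]; ring
    _ ≤ Real.exp (16 * ε ^ 2) ^ m :=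
      pow_le_pow_left₀ (by positivity) (Real.add_one_le_exp _) m
    _ = _ := by rw [← Real.exp_nat_mul]; ring_nf

/-- Squaring absorbs the factor 49/64, because `2 · (49/64)² > 1`. -/
theorem half_log_le_of_le_exp {N : ℕ} (hN : 2 ≤ N) {a : ℝ}
    (h : 49 / 64 * (N : ℝ) ≤ Real.exp a) : 1 / 2 * Real.log N ≤ a := by
  have hN' : (2 : ℝ) ≤ N := by exact_mod_cast hN
  have hsq : (N : ℝ) ≤ Real.exp a ^ 2 := by
    calc (N : ℝ) ≤ (49 / 64 * N) ^ 2 := by nlinarith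
      _ ≤ _ := pow_le_pow_left₀ (by positivity) h 2
  have := Real.log_le_log (by positivity) hsq
  rw [Real.log_pow, Real.log_exp] at this
  push_cast at this
  linarith

theorem log_div_sq_le_of_accurate {n m : ℕ} (hn : 2 ≤ n) (hm : 1 ≤ m) {ε : ℝ} (hε : 0 < ε)
    (hε' : ε < 1 / 50) {M : Competition n m} (hM : IsNonstrategicallyAccurate M ε (1 / 8)) :
    1 / 32 * Real.log n / ε ^ 2 ≤ m := by
  obtain ⟨S, hS2, hSexp, hcode⟩ := exists_code hm
  rcases le_total n S.card with hle | hle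
  · obtain ⟨T, hTS, hTn⟩ := Finset.exists_subset_card_eq hle
    have h := card_code_le_of_accurate hm hε (by linarith) hM
      (Finset.card_pos.1 (by omega)) hTn.le
      fun x hx y hy => hcode x (hTS hx) y (hTS hy)
    rw [hTn] at h
    have := half_log_le_of_le_exp hn h
    rw [div_le_iff₀ (by positivity)]
    linarith
  -- Here all of `S` is used: its logarithm is at least `7m/64`, but also at most `32 ε² m`, which
  -- is smaller as `ε < 1/50`.
  · exfalso
    have h := half_log_le_of_le_exp hS2 (card_code_le_of_accurate hm hε (by linarith) hM
      (Finset.card_pos.1 (by omega)) hle hcode)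
    have hSpos : (0 : ℝ) < S.card := by exact_mod_cast (by omega : 0 < S.card)
    have hlog := Real.log_le_log (by positivity) hSexp
    rw [Real.log_mul hSpos.ne' (by positivity), Real.log_pow, Real.log_pow,
      Real.log_mul (by positivity) (by norm_num), Real.log_sqrt (by norm_num)] at hlog
    have hconst : (7 / 64 : ℝ) ≤ Real.log 2 / 2 - Real.log (5 / 4) := by
      have h1 := Real.one_sub_inv_le_log_of_pos (show (0 : ℝ) < 32 / 25 by norm_num)
      have h2 : Real.log (32 / 25) = Real.log 2 - 2 * Real.log (5 / 4) := by
        rw [show (32 / 25 : ℝ) = 2 / (5 / 4) ^ 2 by norm_num,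
          Real.log_div (by norm_num) (by norm_num), Real.log_pow]
        norm_num
      norm_num at h1
      linarith
    have hm' : (0 : ℝ) < m := by exact_mod_cast hm
    have hε2 : 16 * ε ^ 2 < 7 / 128 := by nlinarith
    nlinarith

theorem mainTheorem4 :
    ∃ C : ℝ, 0 < C ∧ ∃ δ₀ : ℝ, 0 < δ₀ ∧ δ₀ < 1 / 8 ∧ ∃ ε₀ : ℝ, 0 < ε₀ ∧
      (∀ ε : ℝ, 0 < ε → ε < ε₀ → ∀ n m : ℕ, 2 ≤ n → 1 ≤ m → ∀ M : Competition n m,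
        IsNonstrategicallyAccurate M ε δ₀ → C * Real.log (n : ℝ) / ε ^ 2 ≤ (m : ℝ)) ∧
      (∀ M : ForecastingMechanism, ∀ ε : ℝ, 0 < ε → ε < ε₀ → ∀ (n : ℕ) (hn : 2 ≤ n),
        ENNReal.ofReal (C * Real.log (n : ℝ) / ε ^ 2) ≤
          ((nonstrategicEventComplexity M n hn ε (1 / 8) : ℕ∞) : ENNReal)) := by
  -- Any `δ₀` in `(0, 1/8)` would do, since accuracy at `δ₀` implies accuracy at 1/8.
  refine ⟨1 / 32, by norm_num, 1 / 16, by norm_num, by norm_num, 1 / 50, by norm_num, ?_, ?_⟩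
  · intro ε hε hε' n m hn hm M hM
    exact log_div_sq_le_of_accurate hn hm hε hε' fun P θ => le_trans (by norm_num) (hM P θ)
  · intro M ε hε hε' n hn
    have hceil : ((⌈1 / 32 * Real.log (n : ℝ) / ε ^ 2⌉₊ : ℕ) : ℕ∞) ≤
        nonstrategicEventComplexity M n hn ε (1 / 8) :=
      le_iInf₂ fun m hm => Nat.cast_le.2 <| Nat.ceil_le.2 <|
        log_div_sq_le_of_accurate hn hm.1 hε hε' hm.2
    calc ENNReal.ofReal (1 / 32 * Real.log (n : ℝ) / ε ^ 2)
        ≤ ((⌈1 / 32 * Real.log (n : ℝ) / ε ^ 2⌉₊ : ℕ) : ENNReal) :=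
          ENNReal.ofReal_le_of_le_toReal (by simpa using Nat.le_ceil _)
      _ ≤ _ := by
        have := ENat.toENNReal_le.2 hceil
        rwa [ENat.toENNReal_coe] at this
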